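/- Fix a universal (optimal) prefix-free machine and let $K(\sigma)$ be the prefix-free Kolmogorov complexity of a finite binary string $\sigma$. For $X\in 2^\omega$ let $X\restriction n$ be its $n$-bit prefix, and let $\dim(X)=\liminf_{n\to\infty} K(X\restriction n)/n$ be its effective Hausdorff dimension. For $X,Y\in 2^\omega$ let $$d(X,Y)=\limsup_{n\to\infty}\frac{\#\{k<n : X(k)\ne Y(k)\}}{n},$$ and let $X\oplus Y$ be their join, $(X\oplus Y)(2i)=X(i)$, $(X\oplus Y)(2i+1)=Y(i)$. Call $Z\in 2^\omega$ Martin-Löf random if there is a constant $c$ such that $K(Z\restriction n)\ge n-c$ for all $n$. Let $H(p)=-(p\log_2 p+(1-p)\log_2(1-p))$ be the binary entropy function on $[0,1]$ (with $0\log_2 0=0$), and let $H^{-1}$ be the branch of its inverse that maps $[0,1]$ to $[0,1/2]$. Proposition. There is a sequence $Y\in 2^\omega$, of the form $Y=Z\oplus Z$ for a Martin-Löf random sequence $Z$, such that $\dim(Y)=1/2$ and every $X\in 2^\omega$ with $d(X,Y)\le H^{-1}(1/2)$ satisfies $\dim(X)>0$. Hence the naive entropy lower bound $H^{-1}(|\dim(Y)-\dim(X)|)$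 for the distance $d(X,Y)$ is not always optimal: for this $Y$, every $X$ with $\dim(X)=0$ satisfies $d(X,Y)>H^{-1}(|\dim(Y)-\dim(X)|)$. -/

import Mathlib

open Filter

namespace EffDim

/-! ### Prefix-free machines and prefix-free complexity -/

/-- A prefix-free machine: a partial computable function from binary strings to binary strings,
no two distinct elements of whose domain are comparable under the prefix order. -/
def IsPrefixFreeMachine (M : List Bool →. List Bool) : Prop :=
  Partrec M ∧ ∀ p q : List Bool, (M p).Dom → (M q).Dom → p <+: q → p = q

/-- An optimal prefix-free machine: it simulates every prefix-free machine with an additive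
constant overhead in the length of programs. -/
def IsOptimalPrefixFreeMachine (U : List Bool →. List Bool) : Prop :=
  IsPrefixFreeMachine U ∧
    ∀ M : List Bool →. List Bool, IsPrefixFreeMachine M →
      ∃ c : ℕ, ∀ p x : List Bool, x ∈ M p → ∃ q : List Bool, x ∈ U q ∧ q.length ≤ p.length + c

section Existence

open Encodable Nat.Partrec

/-- The `n`-th (program, output) pair enumerated by the machine with index `e`. -/
def item (e n : ℕ) : Option (List Bool × List Bool) :=
  (decode (α := List Bool) n.unpair.2).bind fun p =>
    ((Code.evaln n.unpair.1 (Denumerable.ofNat Code e) n.unpair.2).bind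
      (decode (α := List Bool))).map fun x => (p, x)

/-- The `m`-th pair enumerated by machine `e` has a program comparable with `p`. -/
def clash (e m : ℕ) (p : List Bool) : Bool :=
  Option.casesOn (item e m) false fun a => decide (a.1.take p.length = p.take a.1.length)

/-- The output of the `n`-th pair of machine `e`, provided that its program is `p` and that no
earlier pair has a program comparable with `p`. -/
def sel (e : ℕ) (p : List Bool) (n : ℕ) : Option (List Bool) :=
  if (item e n).map Prod.fst = some p ∧ ∀ m < n, clash e m p = false
  then (item e n).map Prod.snd else none

/-- One step of the universal machine: programs have the form `1^e 0 p`. -/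
def univStep (w : List Bool) (n : ℕ) : Option (List Bool) :=
  if w.findIdx (fun b => !b) < w.length
  then sel (w.findIdx fun b => !b) (w.drop (w.findIdx (fun b => !b) + 1)) n else none

/-- A universal prefix-free machine. -/
def univMachine (w : List Bool) : Part (List Bool) := Nat.rfindOpt (univStep w)

theorem item_prim : Primrec₂ item := by
  have hu : Primrec fun a : ℕ × ℕ => a.2.unpair := Primrec.unpair.comp Primrec.snd
  refine Primrec.option_bind (Primrec.decode.comp (Primrec.snd.comp hu)) ?_
  refine Primrec.option_map (f := fun b : (ℕ × ℕ) × List Bool =>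
    (Code.evaln b.1.2.unpair.1 (Denumerable.ofNat Code b.1.1) b.1.2.unpair.2).bind
      (decode (α := List Bool))) (g := fun b x => (b.2, x)) ?_ ?_
  · refine Primrec.option_bind ?_ (Primrec.decode.comp Primrec.snd)
    have hu' : Primrec fun b : (ℕ × ℕ) × List Bool => b.1.2.unpair := hu.comp Primrec.fst
    exact Code.primrec_evaln.comp (((Primrec.fst.comp hu').pair
      ((Primrec.ofNat Code).comp (Primrec.fst.comp Primrec.fst))).pair (Primrec.snd.comp hu'))
  · exact (Primrec.snd.comp Primrec.fst).pair Primrec.snd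

theorem clash_prim : Primrec fun a : (ℕ × ℕ) × List Bool => clash a.1.1 a.1.2 a.2 := by
  refine Primrec.option_casesOn (item_prim.comp (Primrec.fst.comp Primrec.fst)
    (Primrec.snd.comp Primrec.fst)) (Primrec.const false) ?_
  have h1 : Primrec fun a : ((ℕ × ℕ) × List Bool) × (List Bool × List Bool) =>
      a.2.1.take a.1.2.length :=
    Primrec.list_take.comp (Primrec.list_length.comp (Primrec.snd.comp Primrec.fst))
      (Primrec.fst.comp Primrec.snd)
  have h2 : Primrec fun a : ((ℕ × ℕ) × List Bool) × (List Bool × List Bool) =>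
      a.1.2.take a.2.1.length :=
    Primrec.list_take.comp (Primrec.list_length.comp (Primrec.fst.comp Primrec.snd))
      (Primrec.snd.comp Primrec.fst)
  exact (Primrec.eq.comp h1 h2).decide

theorem sel_prim : Primrec fun a : (ℕ × List Bool) × ℕ => sel a.1.1 a.1.2 a.2 := by
  have hi : Primrec fun a : (ℕ × List Bool) × ℕ => item a.1.1 a.2 :=
    item_prim.comp (Primrec.fst.comp Primrec.fst) Primrec.snd
  refine Primrec.ite (PrimrecPred.and ?_ ?_) (Primrec.option_map hi (Primrec.snd.comp Primrec.snd))
    (Primrec.const none)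
  · exact Primrec.eq.comp (Primrec.option_map hi (Primrec.fst.comp Primrec.snd))
      (Primrec.option_some.comp (Primrec.snd.comp Primrec.fst))
  · have hR : PrimrecRel fun (m : ℕ) (b : ℕ × List Bool) => clash b.1 m b.2 = false :=
      Primrec.eq.comp (clash_prim.comp (((Primrec.fst.comp Primrec.snd).pair Primrec.fst).pair
        (Primrec.snd.comp Primrec.snd))) (Primrec.const false)
    exact (hR.forall_mem_list.comp (Primrec.list_range.comp Primrec.snd) Primrec.fst).of_eq
      (by simp)

theorem univStep_prim : Primrec₂ univStep := by
  have hk : Primrec fun a : List Bool × ℕ => a.1.findIdx fun b => !b :=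
    Primrec.list_findIdx Primrec.fst (Primrec.not.comp Primrec.snd)
  refine Primrec.ite (Primrec.nat_lt.comp hk (Primrec.list_length.comp Primrec.fst)) ?_
    (Primrec.const none)
  exact sel_prim.comp ((hk.pair (Primrec.list_drop.comp (Primrec.succ.comp hk)
    Primrec.fst)).pair Primrec.snd)

theorem sel_spec {e n : ℕ} {p x : List Bool} (h : x ∈ sel e p n) :
    item e n = some (p, x) ∧ ∀ m < n, clash e m p = false := by
  unfold sel at h
  split_ifs at h with hc
  · refine ⟨?_, hc.2⟩
    obtain ⟨h1, -⟩ := hc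
    cases hi : item e n with
    | none => simp [hi] at h1
    | some a =>
      obtain ⟨q, y⟩ := a
      simp [hi] at h1 h
      simp [h1, h]
  · simp at h

theorem clash_of_item {e m : ℕ} {p q x : List Bool} (h : item e m = some (q, x))
    (hpq : p <+: q ∨ q <+: p) : clash e m p = true := by
  unfold clash
  rw [h]
  simp only [decide_eq_true_eq]
  rcases hpq with ⟨t, rfl⟩ | ⟨t, rfl⟩ <;> simp

theorem prefix_of_clash {e m : ℕ} {p : List Bool} (h : clash e m p = true) :
    ∃ q x, item e m = some (q, x) ∧ (p <+: q ∨ q <+: p) := by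
  unfold clash at h
  cases hi : item e m with
  | none => simp [hi] at h
  | some a =>
    obtain ⟨q, y⟩ := a
    simp only [hi, decide_eq_true_eq] at h
    refine ⟨q, y, rfl, ?_⟩
    rcases le_total p.length q.length with hl | hl
    · left
      rw [List.take_of_length_le hl] at h
      rw [← h]; exact List.take_prefix _ _
    · right
      rw [List.take_of_length_le hl] at h
      rw [h]; exact List.take_prefix _ _

theorem sel_prefixFree {e n n' : ℕ} {p p' x x' : List Bool} (h : x ∈ sel e p n)
    (h' : x' ∈ sel e p' n') (hpp : p <+: p') : p = p' := by
  obtain ⟨h1, h2⟩ := sel_spec h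
  obtain ⟨h1', h2'⟩ := sel_spec h'
  rcases lt_trichotomy n n' with hn | rfl | hn
  · simpa [clash_of_item h1 (Or.inr hpp)] using h2' n hn
  · rw [h1] at h1'; simp at h1'; exact h1'.1
  · simpa [clash_of_item h1' (Or.inl hpp)] using h2 n' hn

theorem parse {w : List Bool} (h : w.findIdx (fun b => !b) < w.length) :
    w = List.replicate (w.findIdx fun b => !b) true ++
      false :: w.drop (w.findIdx (fun b => !b) + 1) := by
  induction w with
  | nil => simp at h
  | cons b w ih =>
    cases b with
    | false => simp [List.findIdx_cons]
    | true =>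
      simp only [List.findIdx_cons, Bool.not_true, cond_false, List.length_cons,
        Nat.add_lt_add_iff_right] at h
      simp only [List.findIdx_cons, Bool.not_true, cond_false, List.replicate_succ,
        List.cons_append, List.drop_succ_cons]
      rw [← ih h]

theorem findIdx_unparse (e : ℕ) (p : List Bool) :
    (List.replicate e true ++ false :: p).findIdx (fun b => !b) = e := by
  induction e with
  | zero => simp [List.findIdx_cons]
  | succ e ih => simp [List.replicate_succ, List.findIdx_cons, ih]

theorem unparse_prefix {e e' : ℕ} {p p' : List Bool}
    (h : List.replicate e true ++ false :: p <+: List.replicate e' true ++ false :: p') :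
    e = e' ∧ p <+: p' := by
  induction e generalizing e' with
  | zero =>
    cases e' with
    | zero => simpa using h
    | succ e' => simp [List.replicate_succ] at h
  | succ e ih =>
    cases e' with
    | zero => simp [List.replicate_succ] at h
    | succ e' =>
      simp only [List.replicate_succ, List.cons_append, List.cons_prefix_cons, true_and] at h
      obtain ⟨h1, h2⟩ := ih h
      exact ⟨by rw [h1], h2⟩

theorem univMachine_dom {w : List Bool} (h : (univMachine w).Dom) :
    ∃ e p n x, w = List.replicate e true ++ false :: p ∧ x ∈ sel e p n := by
  obtain ⟨n, x, hx⟩ := Nat.rfindOpt_dom.1 h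
  unfold univStep at hx
  split_ifs at hx with hc
  · exact ⟨_, _, n, x, parse hc, hx⟩
  · simp at hx

theorem univMachine_isPrefixFree : IsPrefixFreeMachine univMachine := by
  refine ⟨Partrec.rfindOpt univStep_prim.to_comp, ?_⟩
  intro w w' hw hw' hpre
  obtain ⟨e, p, n, x, rfl, hx⟩ := univMachine_dom hw
  obtain ⟨e', p', n', x', rfl, hx'⟩ := univMachine_dom hw'
  obtain ⟨rfl, hp⟩ := unparse_prefix hpre
  rw [sel_prefixFree hx hx' hp]

theorem exists_index {M : List Bool →. List Bool} (hM : Partrec M) :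
    ∃ e : ℕ, (∀ n p x, item e n = some (p, x) → x ∈ M p) ∧
      ∀ p x, x ∈ M p → ∃ n, item e n = some (p, x) := by
  obtain ⟨c, hc⟩ := Code.exists_code.1 hM
  refine ⟨encode c, ?_, ?_⟩
  · intro n p x h
    simp only [item, Denumerable.ofNat_encode, Option.bind_eq_some_iff, Option.map_eq_some_iff,
      Prod.mk.injEq] at h
    obtain ⟨q, hq, y, ⟨z, hz, hzy⟩, rfl, rfl⟩ := h
    have := Code.evaln_sound (Option.mem_def.2 hz)
    rw [hc] at this
    simp [hq] at this
    obtain ⟨a, ha, rfl⟩ := this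
    simp at hzy
    rwa [← hzy]
  · intro p x h
    have : encode x ∈ c.eval (encode p) := by
      rw [hc]; simpa using h
    obtain ⟨k, hk⟩ := Code.evaln_complete.1 this
    refine ⟨Nat.pair k (encode p), ?_⟩
    simp [item, Option.mem_def.1 hk]

theorem univMachine_isOptimal : IsOptimalPrefixFreeMachine univMachine := by
  refine ⟨univMachine_isPrefixFree, ?_⟩
  intro M ⟨hM, hpf⟩
  obtain ⟨e, he1, he2⟩ := exists_index hM
  refine ⟨e + 1, fun p x hx => ⟨List.replicate e true ++ false :: p, ?_, ?_⟩⟩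
  · have hex : ∃ n y, item e n = some (p, y) := by
      obtain ⟨n, hn⟩ := he2 p x hx
      exact ⟨n, x, hn⟩
    classical
    obtain ⟨y, hy⟩ := Nat.find_spec hex
    have hmin := fun m (hm : m < Nat.find hex) => Nat.find_min hex hm
    have hsel : y ∈ sel e p (Nat.find hex) := by
      unfold sel
      rw [if_pos]
      · simp [hy]
      · refine ⟨by simp [hy], fun m hm => ?_⟩
        by_contra hcl
        obtain ⟨q, z, hq, hqp⟩ := prefix_of_clash (by simpa using hcl)
        have hzM := he1 _ _ _ hq
        have hqp' : p = q := by
          rcases hqp with h | h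
          · exact hpf p q (Part.dom_iff_mem.2 ⟨_, hx⟩) (Part.dom_iff_mem.2 ⟨_, hzM⟩) h
          · exact (hpf q p (Part.dom_iff_mem.2 ⟨_, hzM⟩) (Part.dom_iff_mem.2 ⟨_, hx⟩) h).symm
        subst hqp'
        exact hmin m hm ⟨z, hq⟩
    have hstep : ∀ n, univStep (List.replicate e true ++ false :: p) n = sel e p n := by
      intro n
      unfold univStep
      rw [findIdx_unparse, if_pos (by simp)]
      congr 1
      simp [List.drop_append]
    have hdom : (univMachine (List.replicate e true ++ false :: p)).Dom :=
      Nat.rfindOpt_dom.2 ⟨_, y, by rw [hstep]; exact hsel⟩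
    obtain ⟨z, hz⟩ := Part.dom_iff_mem.1 hdom
    obtain ⟨n, hn⟩ := Nat.rfindOpt_spec hz
    rw [hstep] at hn
    have hzM := he1 _ _ _ (sel_spec hn).1
    rwa [Part.mem_unique hx hzM]
  · simp; omega

end Existence

/-- The prefix-free Kolmogorov complexity `K σ`: the length of a shortest program for `σ` on the
universal prefix-free machine. -/
noncomputable def K (σ : List Bool) : ℕ :=
  sInf {n : ℕ | ∃ p : List Bool, σ ∈ univMachine p ∧ p.length = n}

/-! ### Infinite sequences -/

/-- The `n`-bit prefix of an infinite binary sequence. -/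
def prefixOf (X : ℕ → Bool) (n : ℕ) : List Bool := (List.range n).map X

/-- The effective (Hausdorff) dimension `liminf K(X↾n) / n`. -/
noncomputable def effDim (X : ℕ → Bool) : ℝ :=
  liminf (fun n : ℕ => (K (prefixOf X n) : ℝ) / n) atTop

/-- The Besicovitch distance: the upper density of the set of places where `X` and `Y` differ. -/
noncomputable def besicovitchDist (X Y : ℕ → Bool) : ℝ :=
  limsup (fun n : ℕ => (((Finset.range n).filter fun k => X k ≠ Y k).card : ℝ) / n) atTop

/-- Martin-Löf randomness: `K(X↾n) ≥ n - O(1)`. -/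
def IsMLRandom (X : ℕ → Bool) : Prop :=
  ∃ c : ℕ, ∀ n : ℕ, n ≤ K (prefixOf X n) + c

/-- The join `X ⊕ Y`, with `X` on the even and `Y` on the odd places. -/
def join (X Y : ℕ → Bool) (n : ℕ) : Bool := if n % 2 = 0 then X (n / 2) else Y (n / 2)

/-- The binary entropy function, with logarithms to base 2. -/
noncomputable def H (p : ℝ) : ℝ := -(p * Real.logb 2 p + (1 - p) * Real.logb 2 (1 - p))

/-- The branch of the inverse of `H` that maps `[0,1]` to `[0,1/2]`. -/
noncomputable def Hinv : ℝ → ℝ := Function.invFunOn H (Set.Icc 0 (1 / 2))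

end EffDim

namespace EffDim

open InformationTheory

/-! Let `Y = Z ⊕ Z` with `Z` random. A prefix of `Y` of length `n` carries the same information as
the first `⌈n/2⌉` bits of `Z`, up to a constant for the lower bound and lower-order terms for the
upper one, so `Y` has dimension `1/2`.

The doubling makes `Y` robust: the even and the odd half of any `X` are both approximations of `Z`.
Suppose that `X` differs from `Y` in `e` of its first `n` places. Code `Z` relative to one half of
`X`, two bits at a time, spending one bit on a pair without errors and three bits on any other pair;
this costs at most one bit per pair plus two per error. There are about `n/4` pairs, and one of the
halves contains at most `e/2` errors, so about `n/4 + e` bits recover about `n/2` bits of `Z` from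
the prefix of `X` (`K_le_K_add_relCode`, `length_relCode_add_le`). Randomness of `Z` then gives
`K(X↾n) ≥ n/4 - e - O(1)`, so `dim X > 0` as soon as `d(X, Y) < 1/4`
(`effDim_pos_of_besicovitchDist_lt`). So crude a code suffices because `H(1/4) > 1/2`, that is,
`Hinv (1/2) < 1/4` (`Hinv_half_lt`). The last claim is the contrapositive.

A random `Z` comes from Kraft's inequality: a martingale that bets on all strings at once is kept at
capital at most `1` (`exists_isMLRandom`). -/

/-! ### Upper bounds for `K` from explicit machines -/

theorem univStep_prefixFree {w w' x x' : List Bool} {n n' : ℕ} (h : x ∈ univStep w n)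
    (h' : x' ∈ univStep w' n') (hp : w <+: w') : w = w' ∧ x = x' := by
  have hw : w = w' := univMachine_isPrefixFree.2 w w' (Nat.rfindOpt_dom.2 ⟨n, x, h⟩)
    (Nat.rfindOpt_dom.2 ⟨n', x', h'⟩) hp
  subst hw
  refine ⟨rfl, ?_⟩
  unfold univStep at h h'
  split_ifs at h h' with hc
  · obtain ⟨h1, h2⟩ := sel_spec h
    obtain ⟨h1', h2'⟩ := sel_spec h'
    -- Of two different stages that select the same program, the later one would clash with the
    -- earlier.
    rcases lt_trichotomy n n' with hn | rfl | hn
    · simpa [clash_of_item h1 (Or.inl List.prefix_rfl)] using h2' n hn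
    · simp_all
    · simpa [clash_of_item h1' (Or.inl List.prefix_rfl)] using h2 n' hn
  · simp at h

theorem K_le_length {σ p : List Bool} (h : σ ∈ univMachine p) : K σ ≤ p.length :=
  Nat.sInf_le ⟨p, h, rfl⟩

/-- A machine given by a search procedure bounds the complexity of its outputs. -/
theorem K_le_of_search (g : List Bool → ℕ → Option (List Bool)) (hg : Primrec₂ g)
    (hpf : ∀ w w' n n' x x', x ∈ g w n → x' ∈ g w' n' → w <+: w' → w = w' ∧ x = x') :
    ∃ c : ℕ, ∀ w n x, x ∈ g w n →
      (∃ p, x ∈ univMachine p) ∧ K x ≤ w.length + c := by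
  have hM : IsPrefixFreeMachine fun w => Nat.rfindOpt (g w) := by
    refine ⟨Partrec.rfindOpt hg.to_comp, fun w w' hw hw' hp => ?_⟩
    obtain ⟨n, x, hx⟩ := Nat.rfindOpt_dom.1 hw
    obtain ⟨n', x', hx'⟩ := Nat.rfindOpt_dom.1 hw'
    exact (hpf _ _ _ _ _ _ hx hx' hp).1
  obtain ⟨c, hc⟩ := univMachine_isOptimal.2 _ hM
  refine ⟨c, fun w n x hx => ?_⟩
  obtain ⟨y, hy⟩ := Part.dom_iff_mem.1 (Nat.rfindOpt_dom.2 ⟨n, x, hx⟩)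
  obtain ⟨n', hn'⟩ := Nat.rfindOpt_spec hy
  -- The search may stop at a stage other than `n`; uniqueness of the output makes this harmless.
  obtain rfl := (hpf _ _ _ _ _ _ hx hn' List.prefix_rfl).2
  obtain ⟨q, hq, hl⟩ := hc w x hy
  exact ⟨⟨q, hq⟩, (K_le_length hq).trans hl⟩

/-- Self-delimiting coding: `1^j 0 σ` describes `F σ` if `σ` has length `ℓ j`. -/
theorem K_le_of_delimited (F : List Bool → List Bool) (hF : Primrec F) (ℓ : ℕ → ℕ)
    (hℓ : Primrec ℓ) : ∃ c : ℕ, ∀ j σ, σ.length = ℓ j →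
      (∃ p, F σ ∈ univMachine p) ∧ K (F σ) ≤ ℓ j + j + c := by
  let g : List Bool → ℕ → Option (List Bool) := fun w _ =>
    if w.length = w.findIdx (fun b => !b) + 1 + ℓ (w.findIdx fun b => !b) then
      some (F (w.drop (w.findIdx (fun b => !b) + 1))) else none
  have hk : Primrec fun a : List Bool × ℕ => a.1.findIdx fun b => !b :=
    Primrec.list_findIdx Primrec.fst (Primrec.not.comp Primrec.snd)
  have hg : Primrec₂ g := by
    refine Primrec.ite (Primrec.eq.comp (Primrec.list_length.comp Primrec.fst)
      (Primrec.nat_add.comp (Primrec.succ.comp hk) (hℓ.comp hk))) ?_ (Primrec.const none)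
    exact Primrec.option_some.comp (hF.comp (Primrec.list_drop.comp (Primrec.succ.comp hk)
      Primrec.fst))
  obtain ⟨c, hc⟩ := K_le_of_search g hg (by
    intro w w' n n' x x' h h' hp
    simp only [g] at h h'
    split_ifs at h h' with h1 h2
    · have e1 := parse (w := w) (by omega)
      have e2 := parse (w := w') (by omega)
      have hj := hp
      rw [e1, e2] at hj
      have hj := (unparse_prefix hj).1
      have : w = w' := hp.eq_of_length (by rw [h1, h2, hj])
      subst this
      rw [Option.mem_def, Option.some.injEq] at h h'
      exact ⟨rfl, h.symm.trans h'⟩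
    all_goals first | exact absurd h (Option.not_mem_none _) | exact absurd h' (Option.not_mem_none _))
  refine ⟨c + 1, fun j σ hσ => ?_⟩
  have := hc (List.replicate j true ++ false :: σ) 0 (F σ) (by
    simp only [g, findIdx_unparse]
    rw [if_pos (by simp; omega)]
    simp [List.drop_append])
  refine ⟨this.1, this.2.trans ?_⟩
  simp; omega

theorem exists_program (σ : List Bool) : ∃ p, σ ∈ univMachine p ∧ p.length = K σ := by
  obtain ⟨c, hc⟩ := K_le_of_delimited id Primrec.id id Primrec.id
  obtain ⟨p, hp⟩ := (hc σ.length σ rfl).1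
  exact Nat.sInf_mem (s := {n : ℕ | ∃ p : List Bool, σ ∈ univMachine p ∧ p.length = n})
    ⟨p.length, p, hp, rfl⟩

theorem exists_K_le_two_mul_length : ∃ c : ℕ, ∀ σ, K σ ≤ 2 * σ.length + c := by
  obtain ⟨c, hc⟩ := K_le_of_delimited id Primrec.id id Primrec.id
  refine ⟨c, fun σ => (hc σ.length σ rfl).2.trans ?_⟩
  simp; omega

/-- A decidable self-delimiting description `r` of `z` given `x` yields `K z ≤ K x + |r| + O(1)`. -/
theorem K_le_K_add (D : List Bool × List Bool × List Bool → Bool) (hD : Primrec D)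
    (hpf : ∀ x r r' z z', D (x, r, z) = true → D (x, r', z') = true → r <+: r' →
      r = r' ∧ z = z') :
    ∃ c : ℕ, ∀ x r z, D (x, r, z) = true → K z ≤ K x + r.length + c := by
  let g : List Bool → ℕ → Option (List Bool) := fun w n =>
    (Encodable.decode (α := ℕ × ℕ × List Bool) n).bind fun a =>
      (univStep (w.take a.1) a.2.1).bind fun x =>
        if D (x, w.drop a.1, a.2.2) = true then some a.2.2 else none
  have hg : Primrec₂ g := by
    refine Primrec.option_bind (Primrec.decode.comp Primrec.snd) ?_
    refine Primrec.option_bind (f := fun b : (List Bool × ℕ) × (ℕ × ℕ × List Bool) =>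
      univStep (b.1.1.take b.2.1) b.2.2.1)
      (g := fun b x => if D (x, b.1.1.drop b.2.1, b.2.2.2) = true then some b.2.2.2 else none) ?_ ?_
    · exact univStep_prim.comp (Primrec.list_take.comp (Primrec.fst.comp Primrec.snd)
        (Primrec.fst.comp Primrec.fst)) (Primrec.fst.comp (Primrec.snd.comp Primrec.snd))
    · have hz : Primrec fun b : ((List Bool × ℕ) × (ℕ × ℕ × List Bool)) × List Bool =>
          b.1.2.2.2 := Primrec.snd.comp (Primrec.snd.comp (Primrec.snd.comp Primrec.fst))
      refine Primrec.ite (Primrec.eq.comp (hD.comp (Primrec.snd.pair (Primrec.pair ?_ hz)))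
        (Primrec.const true)) (Primrec.option_some.comp hz) (Primrec.const none)
      exact Primrec.list_drop.comp (Primrec.fst.comp (Primrec.snd.comp Primrec.fst))
        (Primrec.fst.comp (Primrec.fst.comp Primrec.fst))
  have hspec : ∀ w n z, z ∈ g w n → ∃ k s x, x ∈ univStep (w.take k) s ∧
      D (x, w.drop k, z) = true := by
    intro w n z h
    simp only [g, Option.mem_def, Option.bind_eq_some_iff] at h
    obtain ⟨a, -, x, hx, h⟩ := h
    split_ifs at h with hd
    · simp only [Option.some.injEq] at h
      exact ⟨a.1, a.2.1, x, hx, h ▸ hd⟩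
  obtain ⟨c, hc⟩ := K_le_of_search g hg (by
    intro w w' n n' z z' h h' hp
    obtain ⟨k, s, x, hx, hd⟩ := hspec _ _ _ h
    obtain ⟨k', s', x', hx', hd'⟩ := hspec _ _ _ h'
    have hcomp : w.take k = w'.take k' ∧ x = x' := by
      rcases List.prefix_or_prefix_of_prefix ((List.take_prefix k w).trans hp)
        (List.take_prefix k' w') with h1 | h1
      · exact univStep_prefixFree hx hx' h1
      · have := univStep_prefixFree hx' hx h1
        exact ⟨this.1.symm, this.2.symm⟩
    obtain ⟨h1, rfl⟩ := hcomp
    have hdr : w.drop k <+: w'.drop k' := by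
      rw [← List.take_append_drop k w, ← List.take_append_drop k' w', h1] at hp
      exact (List.prefix_append_right_inj _).1 hp
    obtain ⟨h2, h3⟩ := hpf _ _ _ _ _ hd hd' hdr
    exact ⟨by rw [← List.take_append_drop k w, ← List.take_append_drop k' w', h1, h2], h3⟩)
  refine ⟨c, fun x r z hd => ?_⟩
  obtain ⟨p, hp, hpl⟩ := exists_program x
  obtain ⟨s, hs⟩ := Nat.rfindOpt_spec hp
  have := (hc (p ++ r) (Encodable.encode (p.length, s, z)) z (by
    simp only [g, Encodable.encodek, Option.bind_some, List.take_left, List.drop_left,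
      Option.mem_def]
    rw [Option.mem_def.1 hs]
    simp [hd])).2
  rw [List.length_append, hpl] at this
  exact this

/-! ### Kraft's inequality and the existence of Martin-Löf random sequences -/

/-- Two factorizations of the same word start with comparable, hence equal, codewords, which cancel.
This puts Kraft's inequality in reach of its form for uniquely decodable codes. -/
theorem uniquelyDecodable_of_prefixFree {α : Type*} {S : Set (List α)} (h0 : [] ∉ S)
    (hS : ∀ p ∈ S, ∀ q ∈ S, p <+: q → p = q) : UniquelyDecodable S := by
  intro l
  induction l with
  | nil =>
    intro l' _ h' h
    cases l' with
    | nil => rfl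
    | cons q l' =>
      have : q = [] := by simp at h; exact h.1
      exact absurd (this ▸ h' q (by simp)) h0
  | cons p l ih =>
    intro l' hl h' h
    cases l' with
    | nil =>
      have : p = [] := by simp at h; exact h.1
      exact absurd (this ▸ hl p (by simp)) h0
    | cons q l' =>
      simp only [List.flatten_cons] at h
      have hpq : p = q := by
        rcases List.prefix_or_prefix_of_prefix (List.prefix_append p l.flatten)
          (h ▸ List.prefix_append q l'.flatten) with h1 | h1
        · exact hS p (hl p (by simp)) q (h' q (by simp)) h1
        · exact (hS q (h' q (by simp)) p (hl p (by simp)) h1).symm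
      subst hpq
      rw [ih l' (fun w hw => hl w (by simp [hw])) (fun w hw => h' w (by simp [hw]))
        (List.append_cancel_left h)]

open scoped ENNReal

theorem tsum_two_inv_pow_K_le_one : ∑' σ, (2⁻¹ : ℝ≥0∞) ^ K σ ≤ 1 := by
  choose π hπ hπl using exists_program
  have hinj : Function.Injective π := fun σ τ h =>
    Part.mem_unique (hπ σ) (h ▸ hπ τ)
  rw [ENNReal.tsum_eq_iSup_sum]
  refine iSup_le fun s => ?_
  have hk := kraft_mcmillan_inequality (S := s.image π) (uniquelyDecodable_of_prefixFree
    (by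
      intro h
      simp only [Finset.coe_image, Set.mem_image] at h
      obtain ⟨σ, -, h⟩ := h
      -- The empty word is no program, since every program contains the separator `0` after `1^e`.
      obtain ⟨e, p, n, x, hw, -⟩ := univMachine_dom (Part.dom_iff_mem.2 ⟨_, hπ σ⟩)
      simp [h] at hw)
    (by
      simp only [Finset.coe_image, Set.mem_image]
      rintro _ ⟨σ, -, rfl⟩ _ ⟨τ, -, rfl⟩ h
      exact univMachine_isPrefixFree.2 _ _ (Part.dom_iff_mem.2 ⟨_, hπ σ⟩)
        (Part.dom_iff_mem.2 ⟨_, hπ τ⟩) h))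
  rw [Finset.sum_image hinj.injOn] at hk
  simp only [hπl, Fintype.card_bool] at hk
  have he : ∀ σ, (2⁻¹ : ℝ≥0∞) ^ K σ = ENNReal.ofReal ((1 / ((2 : ℕ) : ℝ)) ^ K σ) := by
    intro σ
    rw [ENNReal.ofReal_pow (by positivity)]
    congr 1
    rw [one_div, ENNReal.ofReal_inv_of_pos (by norm_num)]
    simp
  simp_rw [he]
  rw [← ENNReal.ofReal_sum_of_nonneg (fun _ _ => by positivity)]
  exact ENNReal.ofReal_le_one.2 hk

open Classical in
/-- The martingale that bets on every string `σ` with initial capital `2 ^ (-K σ)`. -/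
noncomputable def capital (τ : List Bool) : ℝ≥0∞ :=
  ∑' σ : List Bool, if σ <+: τ ∨ τ <+: σ then
    2 ^ (min σ.length τ.length) * (2⁻¹ : ℝ≥0∞) ^ K σ else 0

theorem capital_nil_le : capital [] ≤ 1 := by
  refine le_trans (le_of_eq ?_) tsum_two_inv_pow_K_le_one
  simp [capital]

/-- Fairness holds for each `σ` separately: once `σ` is a prefix of `τ` its stake stays constant,
and before that it doubles along `σ` and is lost off `σ`. -/
theorem capital_append_add (τ : List Bool) :
    capital (τ ++ [false]) + capital (τ ++ [true]) = 2 * capital τ := by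
  unfold capital
  rw [← ENNReal.tsum_add, ← ENNReal.tsum_mul_left]
  refine tsum_congr fun σ => ?_
  by_cases h : σ <+: τ
  · have h1 : ∀ b, σ <+: τ ++ [b] := fun b => h.trans (List.prefix_append _ _)
    have hl := h.length_le
    simp only [h, h1, true_or, if_true, List.length_append, List.length_singleton]
    rw [min_eq_left hl, min_eq_left (by omega), two_mul]
  by_cases h' : τ <+: σ
  · obtain ⟨ρ, rfl⟩ := h'
    cases ρ with
    | nil => simp at h
    | cons b ρ =>
      have e1 : min (τ ++ b :: ρ).length (τ ++ [false]).length = τ.length + 1 := by simp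
      have e3 : min (τ ++ b :: ρ).length τ.length = τ.length := by simp
      have e2 : min (τ ++ b :: ρ).length (τ ++ [true]).length = τ.length + 1 := by simp
      rw [e1, e2, e3]
      cases b <;> simp [List.prefix_append_right_inj, List.cons_prefix_cons, pow_succ] <;> ring
  · have h1 : ∀ b, ¬ (σ <+: τ ++ [b] ∨ τ ++ [b] <+: σ) := by
      rintro b (h2 | h2)
      · rcases List.prefix_concat_iff.1 h2 with rfl | h3
        · exact h' (List.prefix_append _ _)
        · exact h h3
      · exact h' ((List.prefix_append _ _).trans h2)
    simp [h, h', h1]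

theorem exists_capital_append_le {τ : List Bool} (h : capital τ ≤ 1) :
    ∃ b, capital (τ ++ [b]) ≤ 1 := by
  by_contra! hc
  have h1 := ENNReal.add_lt_add (hc false) (hc true)
  rw [capital_append_add] at h1
  have h2 : 2 * capital τ ≤ 2 * 1 := by gcongr
  rw [mul_one, ← one_add_one_eq_two] at h2
  exact absurd (h1.trans_le (one_add_one_eq_two (R := ℝ≥0∞) ▸ h2)) (lt_irrefl _)

/-- The bet on `τ` itself already contributes `2 ^ (|τ| - K τ)` to the capital at `τ`. -/
theorem length_le_K_of_capital_le {τ : List Bool} (h : capital τ ≤ 1) : τ.length ≤ K τ := by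
  have h1 := (ENNReal.le_tsum τ).trans h
  simp only [List.prefix_rfl, true_or, if_true, min_self] at h1
  by_contra! hlt
  obtain ⟨d, hd⟩ := Nat.exists_eq_add_of_lt hlt
  have h2 : (2 : ℝ≥0∞) ^ K τ * 2⁻¹ ^ K τ = 1 := by
    rw [← mul_pow, ENNReal.mul_inv_cancel (by norm_num) (by norm_num), one_pow]
  rw [hd, add_assoc, pow_add, mul_right_comm, h2, one_mul] at h1
  have h3 : (2 : ℝ≥0∞) ^ 1 ≤ 2 ^ (d + 1) := pow_le_pow_right₀ (by norm_num) (by omega)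
  exact absurd (h3.trans h1) (by norm_num)

theorem prefixOf_succ (X : ℕ → Bool) (n : ℕ) :
    prefixOf X (n + 1) = prefixOf X n ++ [X n] := by
  simp [prefixOf, List.range_succ]

@[simp]
theorem length_prefixOf (X : ℕ → Bool) (n : ℕ) : (prefixOf X n).length = n := by
  simp [prefixOf]

theorem getD_prefixOf {X : ℕ → Bool} {n i : ℕ} (h : i < n) (d : Bool) :
    (prefixOf X n).getD i d = X i := by
  simp [prefixOf, List.getD_eq_getElem?_getD, h]

theorem exists_isMLRandom : ∃ Z, IsMLRandom Z := by
  choose b hb using fun τ : {τ // capital τ ≤ 1} => exists_capital_append_le τ.2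
  let s : ℕ → {τ // capital τ ≤ 1} := fun n =>
    Nat.rec ⟨[], capital_nil_le⟩ (fun _ τ => ⟨τ.1 ++ [b τ], hb τ⟩) n
  have hs : ∀ n, prefixOf (fun k => b (s k)) n = (s n).1 := by
    intro n
    induction n with
    | zero => rfl
    | succ n ih => rw [prefixOf_succ, ih]
  refine ⟨fun k => b (s k), 0, fun n => ?_⟩
  have := length_le_K_of_capital_le (s n).2
  rw [← hs, length_prefixOf] at this
  exact this

/-! ### Effective dimension -/

/-- A real `liminf` is meaningful only for bounded sequences; this rules out its default value. -/
theorem isBoundedUnder_K_div (X : ℕ → Bool) :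
    IsBoundedUnder (· ≤ ·) atTop fun n : ℕ => (K (prefixOf X n) : ℝ) / n := by
  obtain ⟨c, hc⟩ := exists_K_le_two_mul_length
  refine isBoundedUnder_of_eventually_le (a := (2 + c : ℝ)) ?_
  filter_upwards [eventually_ge_atTop 1] with n hn
  have hn' : (1 : ℝ) ≤ n := by exact_mod_cast hn
  have h : (K (prefixOf X n) : ℝ) ≤ 2 * n + c := by
    have := hc (prefixOf X n)
    rw [length_prefixOf] at this
    exact_mod_cast this
  rw [div_le_iff₀ (by linarith)]
  nlinarith [mul_nonneg (Nat.cast_nonneg (α := ℝ) c) (sub_nonneg.2 hn')]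

theorem isBoundedUnder_ge_K_div (X : ℕ → Bool) :
    IsBoundedUnder (· ≥ ·) atTop fun n : ℕ => (K (prefixOf X n) : ℝ) / n :=
  isBoundedUnder_of_eventually_ge (a := 0) (Eventually.of_forall fun n => by positivity)

theorem le_effDim {X : ℕ → Bool} {a C : ℝ}
    (h : ∀ᶠ n : ℕ in atTop, a * n - C ≤ K (prefixOf X n)) : a ≤ effDim X := by
  -- Half of the gap between `a'` and `a` absorbs `C / n`; the other half keeps the inequality
  -- strict.
  refine le_of_forall_lt fun a' ha => lt_of_lt_of_le (left_lt_add_div_two.2 ha) ?_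
  refine le_liminf_of_le (isBoundedUnder_K_div X).isCoboundedUnder_ge ?_
  have ht : Tendsto (fun n : ℕ => C / (n : ℝ)) atTop (nhds 0) :=
    tendsto_const_div_atTop_nhds_zero_nat C
  filter_upwards [h, ht.eventually_lt_const (show 0 < (a - a') / 2 by linarith),
    eventually_gt_atTop 0] with n hn hC hpos
  have hpos' : (0 : ℝ) < n := by exact_mod_cast hpos
  rw [div_lt_iff₀ hpos'] at hC
  rw [le_div_iff₀ hpos']
  linarith

theorem effDim_le_of_subsequence {X : ℕ → Bool} {a : ℝ} (f : ℕ → ℕ) (hf : Tendsto f atTop atTop)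
    (h : ∀ ε > 0, ∀ᶠ j in atTop, (K (prefixOf X (f j)) : ℝ) / (f j : ℕ) ≤ a + ε) :
    effDim X ≤ a := by
  refine le_of_forall_pos_le_add fun ε hε => ?_
  refine liminf_le_of_frequently_le ?_ (isBoundedUnder_ge_K_div X)
  exact hf.frequently (h ε hε).frequently

/-! ### The join of a random sequence with itself -/

theorem prefixOf_join_self (Z : ℕ → Bool) (n : ℕ) :
    prefixOf (join Z Z) (2 * n) = (prefixOf Z n).flatMap fun b => [b, b] := by
  induction n with
  | zero => rfl
  | succ n ih =>
    rw [mul_add, mul_one, prefixOf_succ, prefixOf_succ, ih, prefixOf_succ, List.flatMap_append]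
    have h1 : join Z Z (2 * n) = Z n := by simp [join]
    have h2 : join Z Z (2 * n + 1) = Z n := by
      simp only [join, ite_self]; congr 1; omega
    simp [h1, h2]

theorem join_self_apply (Z : ℕ → Bool) (n : ℕ) : join Z Z n = Z (n / 2) := by
  simp [join]

theorem effDim_join_self_le (Z : ℕ → Bool) : effDim (join Z Z) ≤ 1 / 2 := by
  obtain ⟨c, hc⟩ := K_le_of_delimited (fun σ => σ.flatMap fun b => [b, b])
    (Primrec.list_flatMap Primrec.id ((Primrec.dom_bool fun b => [b, b]).comp₂ Primrec₂.right))
    (fun j => j * j) (Primrec.nat_mul.comp Primrec.id Primrec.id)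
  -- A `liminf` may be bounded along a subsequence, so the lengths `2 * (j * j)` suffice.
  have hf : Tendsto (fun j : ℕ => 2 * (j * j)) atTop atTop :=
    tendsto_atTop_mono (fun j => (Nat.le_mul_self j).trans (by omega)) tendsto_id
  refine effDim_le_of_subsequence _ hf fun ε hε => ?_
  filter_upwards [(tendsto_const_div_atTop_nhds_zero_nat (1 + c : ℝ)).eventually_lt_const hε,
    eventually_ge_atTop 1] with j hj hj1
  have hj1' : (1 : ℝ) ≤ j := by exact_mod_cast hj1
  have hK : (K (prefixOf (join Z Z) (2 * (j * j))) : ℝ) ≤ j * j + j + c := by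
    have := (hc j (prefixOf Z (j * j)) (by simp)).2
    rw [← prefixOf_join_self] at this
    exact_mod_cast this
  rw [div_lt_iff₀ (by linarith)] at hj
  push_cast
  rw [div_le_iff₀ (by positivity)]
  -- The excess `j + c` is at most `(1 + c) * j`, which is less than `ε * (j * j)`.
  nlinarith [mul_lt_mul_of_pos_right hj (show (0 : ℝ) < j by linarith),
    mul_nonneg (Nat.cast_nonneg (α := ℝ) c) (sub_nonneg.2 hj1'), mul_pos hε (show (0 : ℝ) < j * j by positivity)]

theorem K_le_K_join_self :
    ∃ c : ℕ, ∀ Z n, K (prefixOf Z ((n + 1) / 2)) ≤ K (prefixOf (join Z Z) n) + c := by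
  let E : List Bool → List Bool := fun x =>
    (List.range ((x.length + 1) / 2)).map fun i => x.getD (2 * i) false
  have hE : Primrec E := by
    refine Primrec.list_map (Primrec.list_range.comp (Primrec.nat_div.comp
      (Primrec.succ.comp Primrec.list_length) (Primrec.const 2))) ?_
    exact (Primrec.list_getD false).comp Primrec.fst
      (Primrec.nat_mul.comp (Primrec.const 2) Primrec.snd)
  -- No extra description is needed: `r` is empty, and `z` consists of the bits of `x` at even
  -- places.
  obtain ⟨c, hc⟩ := K_le_K_add (fun a => decide (a.2.1 = [] ∧ a.2.2 = E a.1))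
    ((PrimrecPred.and
      (Primrec.eq.comp (Primrec.fst.comp Primrec.snd) (Primrec.const []))
      (Primrec.eq.comp (Primrec.snd.comp Primrec.snd) (hE.comp Primrec.fst))).decide)
    (by simp +contextual)
  refine ⟨c, fun Z n => ?_⟩
  have h := hc (prefixOf (join Z Z) n) [] (prefixOf Z ((n + 1) / 2)) (by
    simp only [decide_eq_true_eq, true_and, E, length_prefixOf]
    refine List.map_congr_left fun i hi => ?_
    rw [List.mem_range] at hi
    rw [getD_prefixOf (by omega), join_self_apply]
    congr 1; omega)
  simpa using h

theorem le_effDim_join_self {Z : ℕ → Bool} (hZ : IsMLRandom Z) : 1 / 2 ≤ effDim (join Z Z) := by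
  obtain ⟨c, hc⟩ := K_le_K_join_self
  obtain ⟨d, hd⟩ := hZ
  refine le_effDim (C := c + d) (Eventually.of_forall fun n => ?_)
  have h : n ≤ 2 * (K (prefixOf (join Z Z) n) + c + d) := by
    have h1 := hc Z n
    have h2 := hd ((n + 1) / 2)
    omega
  have h' : (n : ℝ) ≤ 2 * (K (prefixOf (join Z Z) n) + c + d) := by exact_mod_cast h
  linarith

/-! ### Coding a sequence relative to an approximation of its join with itself -/

/-- A prefix-free code for pairs of bits in which `(0, 0)` has length one. -/
def pairCode (u v : Bool) : List Bool := if u || v then [true, u, v] else [false]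

theorem pairCode_prefixFree {u v u' v' : Bool} (h : pairCode u v <+: pairCode u' v') :
    u = u' ∧ v = v' := by
  revert u v u' v'; decide

/-- Each error costs at most two bits beyond the one bit that every pair costs. -/
theorem length_pairCode (u v : Bool) :
    (pairCode u v).length ≤ 1 + 2 * (u.toNat + v.toNat) := by
  revert u v; decide

/-- The block of two bits of `z` with index `i`, relative to the bits of `x` at the places
`4i + b` and `4i + 2 + b`. -/
def blockCode (x z : List Bool) (b i : ℕ) : List Bool :=
  pairCode (xor (z.getD (2 * i) false) (x.getD (4 * i + b) false))
    (xor (z.getD (2 * i + 1) false) (x.getD (4 * i + 2 + b) false))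

/-- The code of `z` relative to the bits of `x` at the places congruent to `b` modulo `2`. -/
def relCode (x z : List Bool) (b : ℕ) : List Bool :=
  (List.range (x.length / 4)).flatMap (blockCode x z b)

theorem relCode_prim : Primrec fun a : (List Bool × List Bool) × ℕ => relCode a.1.1 a.1.2 a.2 := by
  refine Primrec.list_flatMap (Primrec.list_range.comp (Primrec.nat_div.comp
    (Primrec.list_length.comp (Primrec.fst.comp Primrec.fst)) (Primrec.const 4))) ?_
  have hx : Primrec fun a : ((List Bool × List Bool) × ℕ) × ℕ => a.1.1.1 :=
    Primrec.fst.comp (Primrec.fst.comp Primrec.fst)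
  have hz : Primrec fun a : ((List Bool × List Bool) × ℕ) × ℕ => a.1.1.2 :=
    Primrec.snd.comp (Primrec.fst.comp Primrec.fst)
  have hb : Primrec fun a : ((List Bool × List Bool) × ℕ) × ℕ => a.1.2 :=
    Primrec.snd.comp Primrec.fst
  have hi : ∀ k, Primrec fun a : ((List Bool × List Bool) × ℕ) × ℕ => k * a.2 := fun k =>
    Primrec.nat_mul.comp (Primrec.const k) Primrec.snd
  have hg : ∀ {l : ((List Bool × List Bool) × ℕ) × ℕ → List Bool} {n}, Primrec l → Primrec n →
      Primrec fun a => (l a).getD (n a) false := fun hl hn => (Primrec.list_getD false).comp hl hn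
  refine (Primrec.dom_bool₂ pairCode).comp ((Primrec.dom_bool₂ xor).comp (hg hz (hi 2))
    (hg hx (Primrec.nat_add.comp (hi 4) hb))) ((Primrec.dom_bool₂ xor).comp
    (hg hz (Primrec.succ.comp (hi 2)))
    (hg hx (Primrec.nat_add.comp (Primrec.nat_add.comp (hi 4) (Primrec.const 2)) hb)))

/-- The first blocks are prefixes of a common word, hence comparable, hence equal; strip them and
repeat. -/
theorem flatMap_prefix_flatMap {α β : Type*} {f g : α → List β}
    (h : ∀ a, f a <+: g a ∨ g a <+: f a → f a = g a) {l : List α}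
    (hl : l.flatMap f <+: l.flatMap g) : ∀ a ∈ l, f a = g a := by
  induction l with
  | nil => simp
  | cons a l ih =>
    simp only [List.flatMap_cons] at hl
    have ha : f a = g a := h a (List.prefix_or_prefix_of_prefix
      ((List.prefix_append _ _).trans hl) (List.prefix_append _ _))
    rw [ha, List.prefix_append_right_inj] at hl
    simpa [ha] using ih hl

theorem eq_of_relCode_prefix {x z z' : List Bool} {b : ℕ} (hz : z.length = 2 * (x.length / 4))
    (hz' : z'.length = 2 * (x.length / 4)) (h : relCode x z b <+: relCode x z' b) : z = z' := by
  have hblock : ∀ i < x.length / 4, z.getD (2 * i) false = z'.getD (2 * i) false ∧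
      z.getD (2 * i + 1) false = z'.getD (2 * i + 1) false := by
    intro i hi
    have := flatMap_prefix_flatMap (fun i h => by
      rcases h with h | h
      · obtain ⟨h1, h2⟩ := pairCode_prefixFree h
        unfold blockCode; rw [h1, h2]
      · obtain ⟨h1, h2⟩ := pairCode_prefixFree h
        unfold blockCode; rw [h1, h2]) h i (List.mem_range.2 hi)
    obtain ⟨h1, h2⟩ := pairCode_prefixFree (this ▸ List.prefix_rfl :
      blockCode x z b i <+: blockCode x z' b i)
    exact ⟨by simpa using h1, by simpa using h2⟩
  refine List.ext_getElem (hz.trans hz'.symm) fun k hk hk' => ?_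
  have hk2 := hblock (k / 2) (by omega)
  rw [← List.getD_eq_getElem z false hk, ← List.getD_eq_getElem z' false hk']
  rcases Nat.mod_two_eq_zero_or_one k with h0 | h1
  · have := hk2.1
    rwa [show 2 * (k / 2) = k by omega] at this
  · have := hk2.2
    rwa [show 2 * (k / 2) + 1 = k by omega] at this

theorem K_le_K_add_relCode : ∃ c : ℕ, ∀ x z b, z.length = 2 * (x.length / 4) → b < 2 →
    K z ≤ K x + (relCode x z b).length + c := by
  have hrel : ∀ b, Primrec fun a : List Bool × List Bool × List Bool =>
      relCode a.1 a.2.2 b := fun b => relCode_prim.comp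
    ((Primrec.fst.pair (Primrec.snd.comp Primrec.snd)).pair (Primrec.const b))
  have hr : Primrec fun a : List Bool × List Bool × List Bool => a.2.1 :=
    Primrec.fst.comp Primrec.snd
  -- The first bit of the description names the half of `x` in use; it accounts for the `1` in `c +
  -- 1` below.
  obtain ⟨c, hc⟩ := K_le_K_add (fun a => decide (a.2.2.length = 2 * (a.1.length / 4) ∧
      (a.2.1 = false :: relCode a.1 a.2.2 0 ∨ a.2.1 = true :: relCode a.1 a.2.2 1)))
    ((PrimrecPred.and
      (Primrec.eq.comp (Primrec.list_length.comp (Primrec.snd.comp Primrec.snd))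
        (Primrec.nat_mul.comp (Primrec.const 2) (Primrec.nat_div.comp
          (Primrec.list_length.comp Primrec.fst) (Primrec.const 4))))
      (PrimrecPred.or
        (Primrec.eq.comp hr (Primrec.list_cons.comp (Primrec.const false) (hrel 0)))
        (Primrec.eq.comp hr (Primrec.list_cons.comp (Primrec.const true) (hrel 1))))).decide)
    (by
      intro x r r' z z' h h' hp
      simp only [decide_eq_true_eq] at h h'
      obtain ⟨hz, rfl | rfl⟩ := h <;> obtain ⟨hz', rfl | rfl⟩ := h' <;>
        simp only [List.cons_prefix_cons, reduceCtorEq, false_and, true_and] at hp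
      all_goals
        obtain rfl := eq_of_relCode_prefix hz hz' hp
        exact ⟨rfl, rfl⟩)
  refine ⟨c + 1, fun x z b hz hb => ?_⟩
  obtain rfl | rfl : b = 0 ∨ b = 1 := by omega
  · have := hc x (false :: relCode x z 0) z (by simp [hz])
    rw [List.length_cons] at this
    omega
  · have := hc x (true :: relCode x z 1) z (by simp [hz])
    rw [List.length_cons] at this
    omega

theorem card_filter_range_four_mul (p : ℕ → Prop) [DecidablePred p] (m : ℕ) :
    ((Finset.range (4 * m)).filter p).card = ∑ i ∈ Finset.range m,
      ((if p (4 * i) then 1 else 0) + (if p (4 * i + 1) then 1 else 0) +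
        (if p (4 * i + 2) then 1 else 0) + (if p (4 * i + 3) then 1 else 0)) := by
  rw [Finset.card_filter]
  induction m with
  | zero => rfl
  | succ m ih =>
    rw [mul_add, mul_one, Finset.sum_range_succ _ m, ← ih]
    simp only [Finset.sum_range_succ]
    ring

/-- Bounding the sum over both halves avoids choosing the better one: each of the `n / 4` blocks of
four places costs `1 + 1` bits, plus two for each error in it. -/
theorem length_relCode_add_le (X Z : ℕ → Bool) (n : ℕ) :
    (relCode (prefixOf X n) (prefixOf Z (2 * (n / 4))) 0).length +
      (relCode (prefixOf X n) (prefixOf Z (2 * (n / 4))) 1).length ≤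
      2 * (n / 4) + 2 * ((Finset.range n).filter fun k => X k ≠ join Z Z k).card := by
  have hlen : ∀ b, (relCode (prefixOf X n) (prefixOf Z (2 * (n / 4))) b).length =
      ∑ i ∈ Finset.range (n / 4),
        (blockCode (prefixOf X n) (prefixOf Z (2 * (n / 4))) b i).length := by
    intro b
    rw [relCode, List.length_flatMap, length_prefixOf]
    rfl
  have hmono : ((Finset.range (4 * (n / 4))).filter fun k => X k ≠ join Z Z k).card ≤
      ((Finset.range n).filter fun k => X k ≠ join Z Z k).card :=
    Finset.card_le_card (Finset.filter_subset_filter _ (Finset.range_subset_range.2 (by omega)))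
  refine le_trans ?_ (Nat.add_le_add_left (Nat.mul_le_mul_left 2 hmono) _)
  rw [card_filter_range_four_mul, hlen, hlen, ← Finset.sum_add_distrib, Finset.mul_sum]
  have hconst : 2 * (n / 4) = ∑ i ∈ Finset.range (n / 4), 2 := by simp [mul_comm]
  conv_rhs => rw [hconst]
  rw [← Finset.sum_add_distrib]
  refine Finset.sum_le_sum fun i hi => ?_
  rw [Finset.mem_range] at hi
  have hZ : ∀ j < 2, (prefixOf Z (2 * (n / 4))).getD (2 * i + j) false = Z (2 * i + j) :=
    fun j hj => getD_prefixOf (by omega) _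
  have hX : ∀ j < 4, (prefixOf X n).getD (4 * i + j) false = X (4 * i + j) :=
    fun j hj => getD_prefixOf (by omega) _
  have hJ : ∀ j, join Z Z (4 * i + j) = Z (2 * i + j / 2) := fun j => by
    rw [join_self_apply]; congr 1; omega
  have hbound : ∀ b < 2, (blockCode (prefixOf X n) (prefixOf Z (2 * (n / 4))) b i).length ≤
      1 + 2 * ((if X (4 * i + b) ≠ Z (2 * i) then 1 else 0) +
        (if X (4 * i + 2 + b) ≠ Z (2 * i + 1) then 1 else 0)) := by
    intro b hb
    refine (length_pairCode _ _).trans (le_of_eq ?_)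
    rw [hX b (by omega), hZ 1 (by omega), add_assoc (4 * i), hX (2 + b) (by omega)]
    have := hZ 0 (by omega)
    rw [add_zero] at this
    rw [this]
    have e : ∀ u v : Bool, (xor u v).toNat = if v ≠ u then 1 else 0 := by decide
    rw [e, e]
  have h0 := hbound 0 (by omega)
  have h1 := hbound 1 (by omega)
  have j0 := hJ 0
  have j1 := hJ 1
  have j2 := hJ 2
  have j3 := hJ 3
  norm_num at j0 j1 j2 j3 h0 h1
  simp only [j0, j1, j2, j3, ne_eq]
  simp only [add_assoc] at h0 h1 ⊢
  norm_num at h0 h1 ⊢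
  omega

theorem isBoundedUnder_density (X Y : ℕ → Bool) : IsBoundedUnder (· ≤ ·) atTop fun n : ℕ =>
    (((Finset.range n).filter fun k => X k ≠ Y k).card : ℝ) / n := by
  refine isBoundedUnder_of_eventually_le (a := 1) (Eventually.of_forall fun n => ?_)
  refine div_le_one_of_le₀ ?_ (Nat.cast_nonneg _)
  exact_mod_cast (Finset.card_filter_le _ _).trans (Finset.card_range n).le

/-- A sequence that is closer than `1/4` to the join of a random sequence with itself has
positive dimension. -/
theorem effDim_pos_of_besicovitchDist_lt {X Z : ℕ → Bool} (hZ : IsMLRandom Z)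
    (h : besicovitchDist X (join Z Z) < 1 / 4) : 0 < effDim X := by
  obtain ⟨δ, hδ, hδ'⟩ := exists_between h
  obtain ⟨c, hc⟩ := K_le_K_add_relCode
  obtain ⟨d, hd⟩ := hZ
  -- The lower bound obtained for the dimension is `1/4 - δ`.
  refine lt_of_lt_of_le (sub_pos.2 hδ') (le_effDim (C := 1 + c + d) ?_)
  filter_upwards [eventually_lt_of_limsup_lt hδ (isBoundedUnder_density _ _),
    eventually_gt_atTop 0] with n hn hpos
  have hpos' : (0 : ℝ) < n := by exact_mod_cast hpos
  rw [div_lt_iff₀ hpos'] at hn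
  have h0 := hc (prefixOf X n) (prefixOf Z (2 * (n / 4))) 0 (by simp) (by omega)
  have h1 := hc (prefixOf X n) (prefixOf Z (2 * (n / 4))) 1 (by simp) (by omega)
  have hl := length_relCode_add_le X Z n
  have hr := hd (2 * (n / 4))
  -- Adding `h0` and `h1` averages over the two halves; the summand `1` pays for rounding in `n /
  -- 4`.
  have key : n ≤ 4 * (K (prefixOf X n) +
      ((Finset.range n).filter fun k => X k ≠ join Z Z k).card + 1 + c + d) := by omega
  have key' : (n : ℝ) ≤ 4 * (K (prefixOf X n) +
      ((Finset.range n).filter fun k => X k ≠ join Z Z k).card + 1 + c + d) := by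
    exact_mod_cast key
  linarith

/-! ### The entropy function -/

theorem H_eq_binEntropy (p : ℝ) : H p = Real.binEntropy p / Real.log 2 := by
  rw [Real.binEntropy_eq_negMulLog_add_negMulLog_one_sub]
  simp only [H, Real.logb, Real.negMulLog]
  ring

theorem Hinv_half_lt : Hinv (1 / 2) < 1 / 4 := by
  have hl2 : 0 < Real.log 2 := Real.log_pos (by norm_num)
  have hcont : Continuous H := by
    rw [funext H_eq_binEntropy]
    exact Real.binEntropy_continuous.div_const _
  -- `Function.invFunOn` is a true inverse only at values that are attained.
  have hmem : (1 / 2 : ℝ) ∈ H '' Set.Icc 0 (1 / 2) := by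
    refine intermediate_value_Icc (by norm_num) hcont.continuousOn ⟨?_, ?_⟩
    · simp [H]
    · rw [H_eq_binEntropy, one_div, Real.binEntropy_two_inv, div_self hl2.ne']
      norm_num
  have h1 : Hinv (1 / 2) ∈ Set.Icc (0 : ℝ) (1 / 2) := Function.invFunOn_mem hmem
  have h2 : H (Hinv (1 / 2)) = 1 / 2 := Function.invFunOn_eq hmem
  by_contra! h
  have h3 : Real.binEntropy (1 / 4) ≤ Real.binEntropy (Hinv (1 / 2)) :=
    Real.binEntropy_strictMonoOn.monotoneOn ⟨by norm_num, by norm_num⟩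
      ⟨h1.1, by simpa using h1.2⟩ h
  rw [H_eq_binEntropy, div_eq_iff hl2.ne'] at h2
  -- In bits, `H(1/4)` is `1/2` plus a positive term, so monotonicity on `[0, 1/2]` excludes `Hinv
  -- (1/2) ≥ 1/4`.
  have h4 : Real.binEntropy (1 / 4) = 1 / 2 * Real.log 2 + 3 / 4 * Real.log (4 / 3) := by
    rw [Real.binEntropy]
    have : Real.log ((1 / 4 : ℝ)⁻¹) = 2 * Real.log 2 := by
      rw [show ((1 / 4 : ℝ)⁻¹) = 2 ^ 2 by norm_num, Real.log_pow]; norm_num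
    rw [this, show ((1 - 1 / 4 : ℝ)⁻¹) = 4 / 3 by norm_num]
    ring
  have h5 : 0 < Real.log (4 / 3) := Real.log_pos (by norm_num)
  linarith

end EffDim

theorem mainTheorem8 :
    ∃ Y : ℕ → Bool,
      (∃ Z : ℕ → Bool, EffDim.IsMLRandom Z ∧ Y = EffDim.join Z Z) ∧
      EffDim.effDim Y = 1 / 2 ∧
      (∀ X : ℕ → Bool, EffDim.besicovitchDist X Y ≤ EffDim.Hinv (1 / 2) → 0 < EffDim.effDim X) ∧
      (∀ X : ℕ → Bool, EffDim.effDim X = 0 →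
        EffDim.Hinv |EffDim.effDim Y - EffDim.effDim X| < EffDim.besicovitchDist X Y) := by
  obtain ⟨Z, hZ⟩ := EffDim.exists_isMLRandom
  have hdim : EffDim.effDim (EffDim.join Z Z) = 1 / 2 :=
    le_antisymm (EffDim.effDim_join_self_le Z) (EffDim.le_effDim_join_self hZ)
  have hpos : ∀ X, EffDim.besicovitchDist X (EffDim.join Z Z) ≤ EffDim.Hinv (1 / 2) →
      0 < EffDim.effDim X := fun X hX =>
    EffDim.effDim_pos_of_besicovitchDist_lt hZ (hX.trans_lt EffDim.Hinv_half_lt)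
  refine ⟨EffDim.join Z Z, ⟨Z, hZ, rfl⟩, hdim, hpos, fun X hX => ?_⟩
  rw [hdim, hX, sub_zero, abs_of_pos (by norm_num)]
  by_contra! h
  exact (hpos X h).ne' hX
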